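/- **Lemma (RTT equilibration).** Let $a,b,d\ge 1$ be integers (physical, bond and logical dimension). A random tensor train (RTT) with $n$ sites is the following random vector in $(\mathbb C^a)^{\otimes n}$. Take a chain of $n$ vertices, either open (internal edges joining vertices $i$ and $i+1$ for $1\le i\le n-1$) or closed (one further edge joining vertex $n$ to vertex $1$). Each vertex carries one physical leg of dimension $a$, one logical leg of dimension $d$ and one leg of dimension $b$ for each end of an internal edge at that vertex. Place at each vertex $v$ the tensor $|\psi_v\rangle=U_v|0\rangle_v$, where $|0\rangle_v$ is an arbitrary fixed unit vector in the tensor product of the leg spaces at $v$ and the unitaries $U_v$ are independent and Haar-random. Contract the two legs of every internal edge with each other (that is, with $\sum_k\langle kk|$), and contract the logical legs with a unit bulk state vector $|\Phi\rangle\in(\mathbb C^d)^{\otimes n}$. Call the resulting (unnormalized) vector $|\psi\rangle$. For a unit reference vector $|\phi\rangle\in(\mathbb C^a)^{\otimes n}$ put $$\frac1{D_{\rm eff}}=a^n\,\frac{\mathbb E\big[|\langle\psi|\phi\rangle|^4\big]}{\big(\mathbb E[\langle\psi|\psi\rangle]\big)^2}.$$ For the chain with internal edge set $E_{\rm int}$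 let $Z_J=e^{-\sum_{e\in E_{\rm int}}J}\sum_{\sigma\in\{\pm1\}^n}e^{\sum_{\langle i,j\rangle\in E_{\rm int}}J\sigma_i\sigma_j}$ be the normalized Ising partition function. For $n\ge1$, a closed chain with $n=1$ has one self-loop, and one with $n=2$ has two parallel edges. 1. For $n\ge1$, $$Z_{\log\sqrt b}=2\Big(1+\frac1b\Big)^{n-1}\ \text{(open)},\qquad Z_{\log\sqrt b}=\Big(1+\frac1b\Big)^{n}+\Big(1-\frac1b\Big)^{n}\ \text{(closed)}.$$ 2. For all $|\Phi\rangle$, $|\phi\rangle$, $$\frac1{D_{\rm eff}}\le\frac{2(1+\frac1b)^{n-1}}{a^n(1+\frac1{adb})^2(1+\frac1{adb^2})^{n-2}}\ \text{(open, } n\ge2),\qquad \frac1{D_{\rm eff}}\le\frac{(1+\frac1b)^n+(1-\frac1b)^n}{a^n(1+\frac1{adb^2})^n}\ \text{(closed, } n\ge1),$$ with equality if $|\Phi\rangle$ and $|\phi\rangle$ are both product vectors. 3. For $n\ge1$, both boundary conditions and all $|\Phi\rangle$, $|\phi\rangle$, $\ 1/D_{\rm eff}\le(2/a)^n$. 4.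 (Perfect equilibration.) If $a\ge2$, then for both boundary conditions, all $b,d\ge1$ and any choice of the states $|0\rangle_v,|\Phi\rangle,|\phi\rangle$ for each $n$, $\ \lim_{n\to\infty}1/D_{\rm eff}=0$. 5. (Finite or infinite $b$, $d$.) Let $a\ge2$ and $b,d\in\{1,2,\dots\}\cup\{\infty\}$ with $(a,b,d)\ne(2,1,\infty)$. For infinite $b$ and/or $d$ let $1/D_{\rm eff}$ denote, at each fixed $n$, the upper limit of the inverse effective dimension as the corresponding finite dimension(s) tend to infinity (jointly if both do), for any choice of the states at each $n$ and each pair of finite dimensions. Then again $\lim_{n\to\infty}1/D_{\rm eff}=0$ for both boundary conditions. -/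

import Mathlib

open MeasureTheory Filter Topology

noncomputable section

namespace RTN

/-! ### Haar probability measure on the unitary group -/

/-- The Borel sigma-algebra on the unitary group. -/
instance instMeasurableSpaceUnitary (I : Type) [Fintype I] [DecidableEq I] :
    MeasurableSpace (Matrix.unitaryGroup I ℂ) := borel _

instance instBorelSpaceUnitary (I : Type) [Fintype I] [DecidableEq I] :
    BorelSpace (Matrix.unitaryGroup I ℂ) := ⟨rfl⟩

instance instCompactSpaceUnitary (I : Type) [Fintype I] [DecidableEq I] :
    CompactSpace (Matrix.unitaryGroup I ℂ) := by
  have hK : IsCompact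
      (Set.pi Set.univ fun _ : I => Set.pi Set.univ fun _ : I => Metric.closedBall (0 : ℂ) 1) :=
    isCompact_univ_pi fun _ => isCompact_univ_pi fun _ => isCompact_closedBall _ _
  have hC : IsCompact (unitary (Matrix I I ℂ) : Set (Matrix I I ℂ)) := by
    refine IsCompact.of_isClosed_subset (X := Matrix I I ℂ) hK isClosed_unitary ?_
    intro U hU i _ j _
    rw [mem_closedBall_zero_iff]
    exact entry_norm_bound_of_unitary hU i j
  exact isCompact_iff_compactSpace.mp hC

/-- The Haar measure of total mass one on the unitary group. -/
def haarUnitary (I : Type) [Fintype I] [DecidableEq I] : Measure (Matrix.unitaryGroup I ℂ) :=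
  Measure.haarMeasure ⊤

/-! ### Tensor networks -/

/-- The vectors of norm one in `ℂ^ι`. -/
def UnitVec (ι : Type) [Fintype ι] : Type := {v : ι → ℂ // ∑ i, ‖v i‖ ^ 2 = 1}

/-- The graph of a tensor network, with vertices `V`, internal edges `E` and external edges
(physical sites) `X`. An internal edge has two endpoints, an external edge has one. -/
structure Graph (V E X : Type) where
  src : E → V
  tgt : E → V
  site : X → V

variable {V E X : Type}

/-- The endpoint of a half-edge; `(e, false)` and `(e, true)` are the two halves of `e`. -/
def Graph.endpoint (G : Graph V E X) (h : E × Bool) : V :=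
  if h.2 then G.tgt h.1 else G.src h.1

/-- The basis index of the tensor at the vertex `v`: one index for each physical leg, one logical
index, and one index for each internal leg at `v`. -/
abbrev Graph.Leg [DecidableEq V] (G : Graph V E X) (a b d : ℕ) (v : V) : Type :=
  ({x : X // G.site x = v} → Fin a) × Fin d × ({h : E × Bool // G.endpoint h = v} → Fin b)

variable [Fintype V] [DecidableEq V] [Fintype E] [DecidableEq E] [Fintype X] [DecidableEq X]

/-- The states that enter a random tensor network with physical, bond and logical dimensions
`a`, `b`, `d`: an arbitrary reference vector `|0⟩` for each tensor, the logical bulk state `|Φ⟩`,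
and the boundary reference state `|φ⟩` with which the overlap is taken. -/
structure States (G : Graph V E X) (a b d : ℕ) where
  ref : ∀ v, UnitVec (G.Leg a b d v)
  bulk : UnitVec (V → Fin d)
  bdy : UnitVec (X → Fin a)

/-- A vector on several sites is a product vector. -/
def IsProductVec {ι : Type} [Fintype ι] {k : ℕ} (v : (ι → Fin k) → ℂ) : Prop :=
  ∃ f : ι → Fin k → ℂ, ∀ x, v x = ∏ i, f i (x i)

namespace States

variable {G : Graph V E X} {a b d : ℕ}

/-- Neither the bulk state nor the boundary reference state is entangled. -/
def Unentangled (S : States G a b d) : Prop :=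
  IsProductVec S.bulk.1 ∧ IsProductVec S.bdy.1

/-- The tensor network state vector `⟨Φ| ⨂ₑ ⟨e| ⨂ᵥ Uᵥ|0⟩` (not normalized): both half-edges of an
internal edge carry the same index, which is summed over, and the logical indices are contracted
with the bulk state. -/
def psi (S : States G a b d) (U : ∀ v, Matrix.unitaryGroup (G.Leg a b d v) ℂ)
    (x : X → Fin a) : ℂ :=
  ∑ l : V → Fin d, ∑ β : E → Fin b, star (S.bulk.1 l) *
    ∏ v, ((U v : Matrix (G.Leg a b d v) (G.Leg a b d v) ℂ).mulVec (S.ref v).1)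
      (fun i => x i.1, l v, fun h => β h.1.1)

/-- The law of the unitaries: independent and Haar-random. -/
def law (_S : States G a b d) : Measure (∀ v, Matrix.unitaryGroup (G.Leg a b d v) ℂ) :=
  Measure.pi fun v => haarUnitary (G.Leg a b d v)

/-- The inverse effective dimension `1 / D_eff = aⁿ 𝔼[|⟨ψ|φ⟩|⁴] / (𝔼[⟨ψ|ψ⟩])²`, with `n` the number
of physical sites. -/
def invEffDim (S : States G a b d) : ℝ :=
  (a : ℝ) ^ Fintype.card X *
    (∫ U, ‖∑ x, star (S.psi U x) * S.bdy.1 x‖ ^ 4 ∂S.law) /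
      (∫ U, ∑ x, ‖S.psi U x‖ ^ 2 ∂S.law) ^ 2

end States

/-- The Ising partition function with coupling `J` on the internal edges, normalized by the
contribution of a configuration of equal spins. -/
def Graph.isingZ (G : Graph V E X) (J : ℝ) : ℝ :=
  (1 / Real.exp (∑ _e : E, J)) *
    ∑ σ : V → ℤˣ, Real.exp (∑ e, J * ((σ (G.src e) : ℤ) : ℝ) * ((σ (G.tgt e) : ℤ) : ℝ))

/-! ### Random tensor trains -/

/-- Boundary conditions of a chain. -/
inductive BC
  | opn
  | closed

/-- The number of internal edges of a chain of `n` tensors. -/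
def BC.edges : BC → ℕ → ℕ
  | .opn, n => n - 1
  | .closed, n => n

/-- The chain of `n` tensors with one physical site per tensor. Internal edges join neighbours
`e` and `e + 1`; in the closed chain one more edge joins the last tensor to the first. -/
def train : (bc : BC) → (n : ℕ) → Graph (Fin n) (Fin (bc.edges n)) (Fin n)
  | .opn, n =>
    { src := fun e => ⟨e.1, by have := e.2; simp only [BC.edges] at this; omega⟩
      tgt := fun e => ⟨e.1 + 1, by have := e.2; simp only [BC.edges] at this; omega⟩
      site := id }
  | .closed, n =>
    { src := fun e => e
      tgt := fun e => ⟨(e.1 + 1) % n, Nat.mod_lt _ (Nat.zero_lt_of_lt e.2)⟩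
      site := id }

/-- How a dimension runs in a limit: it is fixed if finite, and tends to infinity if infinite. -/
def dimFilter (β : WithTop ℕ+) : Filter ℕ+ :=
  WithTop.recTopCoe (C := fun _ => Filter ℕ+) atTop (fun b => pure b) β

/-- The upper limit of `f b d` as `b → β` and `d → δ` (so `f b d` itself where both `β = b` and
`δ = d` are finite). It is taken in the extended reals, so that it is always meaningful. -/
def upperLim (f : ℕ+ → ℕ+ → ℝ) (β δ : WithTop ℕ+) : EReal :=
  limsup (fun p : ℕ+ × ℕ+ => (f p.1 p.2 : EReal)) (dimFilter β ×ˢ dimFilter δ)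

end RTN

end

open RTN

open MeasureTheory Filter Topology

noncomputable section

set_option linter.unusedSectionVars false

namespace RTN

/-! ### Moments of a Haar-random unit vector -/

section Haar

/-! For a Haar-random unit vector in dimension D, the second moment of its projector is (1 + swap) /
(D (D + 1)) (`quartic_eq`). By independence, the fourth moment of the overlap becomes a sum over
configurations of one spin per vertex, the spin choosing identity or swap there
(`integral_amplitude_pow_four`). At fixed spins the sum over leg indices factorises: physical and
logical legs give purities of reductions of φ and Φ, and an internal edge gives b² for equal spins
and b for unequal ones. The mean norm needs only first moments. In the quotient the constants
combine to 1 / (aⁿ ∏ᵥ (1 + 1/Dᵥ)) (`States.invEffDim_eq_sum_purity`). Purities have norm at most 1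
and equal 1 for product vectors, so on any graph the bound is an Ising partition function with
e^(-2J) = 1/b.

On a chain the transfer matrix, with eigenvalues 1 ± 1/b, evaluates this sum (`sum_prod_link`). The
result is at most 2 `rate` ^ n, where `rate` < 1 for a ≥ 2. Along the dimension limits `rate` stays
below some ρ < 1 unless (a, b, d) = (2, 1, ∞) (`exists_rate_le`), which makes the bound uniform
before the upper limit is taken. -/

instance isProbabilityMeasure_haarUnitary (I : Type) [Fintype I] [DecidableEq I] :
    IsProbabilityMeasure (haarUnitary I) :=
  ⟨by simpa [haarUnitary] using
    Measure.haarMeasure_self (K₀ := (⊤ : TopologicalSpace.PositiveCompacts (Matrix.unitaryGroup I ℂ)))⟩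

instance isMulLeftInvariant_haarUnitary (I : Type) [Fintype I] [DecidableEq I] :
    (haarUnitary I).IsMulLeftInvariant := by
  unfold haarUnitary; infer_instance

variable {I : Type} [Fintype I] [DecidableEq I]

/-- The vector `U r`. -/
def randVec (r : I → ℂ) (U : Matrix.unitaryGroup I ℂ) : I → ℂ :=
  (U : Matrix I I ℂ).mulVec r

theorem continuous_randVec (r : I → ℂ) (i : I) : Continuous fun U => randVec r U i := by
  have h : Continuous fun U : Matrix.unitaryGroup I ℂ => (U : Matrix I I ℂ).mulVec r :=
    Continuous.matrix_mulVec continuous_subtype_val continuous_const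
  exact (continuous_apply i).comp h

theorem integrable_of_continuous {f : Matrix.unitaryGroup I ℂ → ℂ} (hf : Continuous f) :
    Integrable f (haarUnitary I) :=
  hf.integrable_of_hasCompactSupport (HasCompactSupport.of_compactSpace f)

/-- Left invariance of the Haar measure. The moments follow from this for two kinds of g, diagonal
phases and one reflection, together with normalization. -/
theorem integral_mul_randVec (r : I → ℂ) (g : Matrix.unitaryGroup I ℂ) (f : (I → ℂ) → ℂ) :
    ∫ U, f ((g : Matrix I I ℂ).mulVec (randVec r U)) ∂haarUnitary I =
      ∫ U, f (randVec r U) ∂haarUnitary I := by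
  rw [← integral_mul_left_eq_self (fun U => f (randVec r U)) g]
  simp [randVec, Matrix.mulVec_mulVec]

theorem sum_randVec_mul_star (r : UnitVec I) (U : Matrix.unitaryGroup I ℂ) :
    ∑ i, randVec r.1 U i * star (randVec r.1 U i) = 1 := by
  have h1 : ∑ i, randVec r.1 U i * star (randVec r.1 U i)
      = dotProduct (star (randVec r.1 U)) (randVec r.1 U) := by
    simp [dotProduct, mul_comm]
  have h2 : star (U : Matrix I I ℂ) * (U : Matrix I I ℂ) = 1 :=
    Matrix.UnitaryGroup.star_mul_self U
  rw [h1, randVec, Matrix.star_mulVec, Matrix.dotProduct_mulVec, Matrix.vecMul_vecMul,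
    ← Matrix.star_eq_conjTranspose, h2, Matrix.vecMul_one]
  have h3 := r.2
  have h4 : dotProduct (star r.1) r.1 = ((∑ i, ‖r.1 i‖ ^ 2 : ℝ) : ℂ) := by
    simp [dotProduct, Complex.conj_mul']
  rw [h4, h3]; simp

/-- The quartic moments of `U r`. -/
def quartic (r : I → ℂ) (i j k l : I) : ℂ :=
  ∫ U, randVec r U i * randVec r U j * star (randVec r U k) * star (randVec r U l) ∂haarUnitary I

theorem continuous_quartic (r : I → ℂ) (i j k l : I) :
    Continuous fun U => randVec r U i * randVec r U j * star (randVec r U k) *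
      star (randVec r U l) :=
  (((continuous_randVec r i).mul (continuous_randVec r j)).mul
    (continuous_randVec r k).star).mul (continuous_randVec r l).star

theorem diagonal_mem_unitaryGroup {c : I → ℂ} (hc : ∀ i, c i * star (c i) = 1) :
    Matrix.diagonal c ∈ Matrix.unitaryGroup I ℂ := by
  rw [Matrix.mem_unitaryGroup_iff, Matrix.star_eq_conjTranspose, Matrix.diagonal_conjTranspose,
    Matrix.diagonal_mul_diagonal]
  simp only [Pi.star_apply, hc, Matrix.diagonal_one]

theorem quartic_phase (r : I → ℂ) {c : I → ℂ} (hc : ∀ i, c i * star (c i) = 1) (i j k l : I) :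
    quartic r i j k l = c i * c j * star (c k) * star (c l) * quartic r i j k l := by
  have h := integral_mul_randVec r ⟨_, diagonal_mem_unitaryGroup hc⟩
    (fun y => y i * y j * star (y k) * star (y l))
  simp only [Matrix.mulVec_diagonal] at h
  unfold quartic
  rw [← integral_const_mul, ← h]
  congr 1; ext U
  simp only [star_mul']; ring

theorem quartic_eq_zero (r : I → ℂ) {i j k l : I} (h1 : ¬(i = k ∧ j = l)) (h2 : ¬(i = l ∧ j = k)) :
    quartic r i j k l = 0 := by
  by_contra hne
  -- A phase `Complex.I` on coordinate p alone multiplies the moment by a power of it with exponent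
  -- between -2 and 2. This is 1 only for exponent 0, so p occurs equally often in (i, j) and (k,
  -- l); a sign -1 would not detect a difference of 2. The cases p = i and p = j suffice.
  have key : ∀ p : I, (if i = p then Complex.I else 1) * (if j = p then Complex.I else 1) *
      star (if k = p then Complex.I else 1) * star (if l = p then Complex.I else 1) = 1 := by
    intro p
    have := quartic_phase r (c := fun q => if q = p then Complex.I else 1)
      (by intro q; split_ifs <;> simp) i j k l
    exact mul_right_cancel₀ hne (by rw [one_mul]; exact this.symm)
  have ki := key i
  have kj := key j
  clear key
  rw [@eq_comm I i k, @eq_comm I j l] at h1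
  rw [@eq_comm I i l, @eq_comm I j k] at h2
  have e1 : Complex.I ≠ 1 := fun h => by simpa using congrArg Complex.re h
  have e2 : -Complex.I ≠ 1 := fun h => by simpa using congrArg Complex.re h
  have e3 : (-1 : ℂ) ≠ 1 := by norm_num
  by_cases a1 : j = i
  · subst a1
    by_cases a2 : k = j <;> by_cases a3 : l = j <;> simp_all
  · have a1' : ¬i = j := fun h => a1 h.symm
    by_cases a2 : k = i
    · subst a2
      by_cases a3 : l = k <;> by_cases a5 : l = j <;> simp_all
    · by_cases a3 : l = i
      · subst a3
        by_cases a4 : k = j <;> simp_all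
      · simp_all

theorem one_sub_mem_unitaryGroup {P : Matrix I I ℂ} (hP : P.conjTranspose = P) (hPP : P * P = (2 : ℂ) • P) :
    1 - P ∈ Matrix.unitaryGroup I ℂ := by
  rw [Matrix.mem_unitaryGroup_iff, Matrix.star_eq_conjTranspose, Matrix.conjTranspose_sub, hP,
    Matrix.conjTranspose_one, mul_sub, sub_mul, sub_mul, hPP, two_smul]
  simp

/-- Householder reflection along w = eᵢ - 2eⱼ. Since |w|² = 5, its entries are the rational 3/5 and
4/5. -/
theorem exists_reflection {i j : I} (hij : i ≠ j) : ∃ g : Matrix.unitaryGroup I ℂ,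
    ∀ y : I → ℂ, (g : Matrix I I ℂ).mulVec y i = 3 / 5 * y i + 4 / 5 * y j ∧
      (g : Matrix I I ℂ).mulVec y j = 4 / 5 * y i - 3 / 5 * y j := by
  let w : I → ℂ := Pi.single i 1 - (2 : ℂ) • Pi.single j 1
  have hw : star w = w := by
    ext q; simp only [w, Pi.star_apply, Pi.sub_apply, Pi.smul_apply, Pi.single_apply]
    split_ifs <;> simp
  have hwy : ∀ y : I → ℂ, dotProduct w y = y i - 2 * y j := by
    intro y; simp [w, sub_dotProduct, smul_dotProduct]
  have hwi : w i = 1 := by simp [w, hij]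
  have hwj : w j = -2 := by simp [w, hij.symm]
  let P : Matrix I I ℂ := (2 / 5 : ℂ) • Matrix.vecMulVec w w
  have hP : P.conjTranspose = P := by
    simp only [P, Matrix.conjTranspose_smul, Matrix.conjTranspose_vecMulVec, hw]
    congr 1; simp
  have hPP : P * P = (2 : ℂ) • P := by
    simp only [P, Matrix.smul_mul, Matrix.mul_smul, Matrix.vecMulVec_mul_vecMulVec, hwy, hwi, hwj,
      smul_smul]
    rw [Matrix.vecMulVec_smul, smul_smul]
    norm_num
  refine ⟨⟨1 - P, one_sub_mem_unitaryGroup hP hPP⟩, fun y => ?_⟩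
  have hy : ∀ q, (1 - P).mulVec y q = y q - 2 / 5 * (y i - 2 * y j) * w q := by
    intro q
    simp [P, Matrix.sub_mulVec, Matrix.smul_mulVec, Matrix.vecMulVec_mulVec, hwy]
    ring
  constructor
  · rw [hy, hwi]; ring
  · rw [hy, hwj]; ring

/-- Of the 16 terms only those with balanced phases survive: two pure ones and four mixed ones, the
latter all equal. -/
theorem quartic_linear (r : I → ℂ) {i j : I} (hij : i ≠ j) (p q : ℝ) :
    ∫ U, (p * randVec r U i + q * randVec r U j) * (p * randVec r U i + q * randVec r U j) *
      star (p * randVec r U i + q * randVec r U j) *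
      star (p * randVec r U i + q * randVec r U j) ∂haarUnitary I =
    p ^ 4 * quartic r i i i i + q ^ 4 * quartic r j j j j
      + 4 * p ^ 2 * q ^ 2 * quartic r i j i j := by
  have e : ∀ U : Matrix.unitaryGroup I ℂ,
      (p * randVec r U i + q * randVec r U j) * (p * randVec r U i + q * randVec r U j) *
      star (p * randVec r U i + q * randVec r U j) *
      star (p * randVec r U i + q * randVec r U j) =
      ∑ m : Fin 2 × Fin 2 × Fin 2 × Fin 2, ((![p, q] m.1 * ![p, q] m.2.1 * ![p, q] m.2.2.1 *
        ![p, q] m.2.2.2 : ℝ) : ℂ) * (randVec r U (![i, j] m.1) * randVec r U (![i, j] m.2.1) *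
        star (randVec r U (![i, j] m.2.2.1)) * star (randVec r U (![i, j] m.2.2.2))) := by
    intro U
    simp only [Fintype.sum_prod_type, Fin.sum_univ_two, Matrix.cons_val_zero, Matrix.cons_val_one,
      star_add, star_mul', Complex.ofReal_mul, Complex.star_def, Complex.conj_ofReal]
    ring
  simp_rw [e]
  rw [integral_finsetSum _ fun m _ =>
    (integrable_of_continuous (continuous_quartic r _ _ _ _)).const_mul _]
  simp_rw [integral_const_mul]
  have hc : quartic r i j j i = quartic r i j i j := by
    unfold quartic; congr 1; ext U; ring
  have hc' : quartic r j i i j = quartic r i j i j := by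
    unfold quartic; congr 1; ext U; ring
  have hc'' : quartic r j i j i = quartic r i j i j := by
    unfold quartic; congr 1; ext U; ring
  have hz : ∀ k l m n : I, ¬(k = m ∧ l = n) → ¬(k = n ∧ l = m) → quartic r k l m n = 0 :=
    fun k l m n h h' => quartic_eq_zero r h h'
  simp only [Fintype.sum_prod_type, Fin.sum_univ_two, Matrix.cons_val_zero, Matrix.cons_val_one]
  simp only [← quartic.eq_1]
  rw [hz i i i j (by simp [hij]) (by simp [hij]), hz i i j i (by simp [hij]) (by simp [hij]),
    hz i j i i (by simp [hij.symm]) (by simp [hij.symm]),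
    hz j i i i (by simp [hij.symm]) (by simp [hij.symm]),
    hz j j j i (by simp [hij.symm]) (by simp [hij.symm]),
    hz j j i j (by simp [hij.symm]) (by simp [hij.symm]),
    hz j i j j (by simp [hij]) (by simp [hij]), hz i j j j (by simp [hij]) (by simp [hij]),
    hz i i j j (by simp [hij]) (by simp [hij]),
    hz j j i i (by simp [hij.symm]) (by simp [hij.symm]), hc, hc', hc'']
  push_cast
  ring

theorem quartic_relations (r : I → ℂ) {i j : I} (hij : i ≠ j) :
    quartic r i i i i = quartic r j j j j ∧ quartic r i i i i = 2 * quartic r i j i j := by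
  obtain ⟨g, hg⟩ := exists_reflection hij
  have h1 := integral_mul_randVec r g (fun y => y i * y i * star (y i) * star (y i))
  have h2 := integral_mul_randVec r g (fun y => y j * y j * star (y j) * star (y j))
  simp only [hg] at h1 h2
  have q1 := quartic_linear r hij (3 / 5) (4 / 5)
  have q2 := quartic_linear r hij (4 / 5) (-3 / 5)
  have e1 : quartic r i i i i = ((3 / 5 : ℝ) : ℂ) ^ 4 * quartic r i i i i +
      ((4 / 5 : ℝ) : ℂ) ^ 4 * quartic r j j j j +
      4 * ((3 / 5 : ℝ) : ℂ) ^ 2 * ((4 / 5 : ℝ) : ℂ) ^ 2 * quartic r i j i j := by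
    rw [← q1, quartic, ← h1]; congr 1; ext U; push_cast; ring
  have e2 : quartic r j j j j = ((4 / 5 : ℝ) : ℂ) ^ 4 * quartic r i i i i +
      ((-3 / 5 : ℝ) : ℂ) ^ 4 * quartic r j j j j +
      4 * ((4 / 5 : ℝ) : ℂ) ^ 2 * ((-3 / 5 : ℝ) : ℂ) ^ 2 * quartic r i j i j := by
    rw [← q2, quartic, ← h2]; congr 1; ext U
    have : (4 / 5 * randVec r U i - 3 / 5 * randVec r U j) =
      (((4 / 5 : ℝ) : ℂ) * randVec r U i + ((-3 / 5 : ℝ) : ℂ) * randVec r U j) := by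
      push_cast; ring
    rw [this]
  push_cast at e1 e2
  constructor
  -- With A, B the two pure moments and C the mixed one, the difference of the equations is
  -- (32/25)(A - B) = 0. Then the first one reads 288 A = 576 C, up to the factor 1/625.
  · linear_combination (25 / 32 : ℂ) * (e1 - e2)
  · linear_combination (625 / 288 : ℂ) * e1 - (256 / 288 : ℂ) * (25 / 32 : ℂ) * (e1 - e2)

/-- The two ways to pair `(i, j)` with `(k, l)`, labelled by a spin. -/
def pairing {J : Type} [DecidableEq J] (τ : ℤˣ) (i j k l : J) : ℂ :=
  if τ = 1 then (if i = k ∧ j = l then 1 else 0) else (if i = l ∧ j = k then 1 else 0)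

theorem sum_units_int {M : Type*} [AddCommMonoid M] (f : ℤˣ → M) : ∑ τ, f τ = f 1 + f (-1) := by
  rw [show (Finset.univ : Finset ℤˣ) = {1, -1} from rfl, Finset.sum_pair (by decide)]

/-- Second moments of the projector on a Haar-random unit vector. -/
theorem quartic_eq (r : UnitVec I) (i j k l : I) :
    quartic r.1 i j k l =
      ((Fintype.card I : ℂ) * (Fintype.card I + 1))⁻¹ * ∑ τ : ℤˣ, pairing τ i j k l := by
  have hA : ∀ p, quartic r.1 p p p p = quartic r.1 i i i i := by
    intro p
    by_cases h : p = i
    · rw [h]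
    · exact (quartic_relations r.1 h).1
  have hB : ∀ p q, quartic r.1 p q p q =
      (quartic r.1 i i i i / 2) * (1 + if p = q then 1 else 0) := by
    intro p q
    split_ifs with h
    · subst h; rw [hA]; ring
    · have := (quartic_relations r.1 h).2
      rw [hA] at this; rw [this]; ring
  -- The square of the normalization Σ |vₚ|² = 1 fixes the one constant left undetermined by
  -- invariance.
  have hsum : ∑ p, ∑ q, quartic r.1 p q p q = 1 := by
    unfold quartic
    have hint : ∀ p q, Integrable (fun U => randVec r.1 U p * randVec r.1 U q *
        star (randVec r.1 U p) * star (randVec r.1 U q)) (haarUnitary I) :=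
      fun p q => integrable_of_continuous (continuous_quartic r.1 _ _ _ _)
    simp_rw [← integral_finsetSum _ fun q _ => hint _ q]
    rw [← integral_finsetSum _ fun p _ => integrable_finsetSum _ fun q _ => hint p q]
    have : ∀ U, ∑ p, ∑ q, randVec r.1 U p * randVec r.1 U q *
        star (randVec r.1 U p) * star (randVec r.1 U q) = 1 := by
      intro U
      rw [← mul_one (1 : ℂ), ← sum_randVec_mul_star r U, Finset.sum_mul_sum]
      refine Finset.sum_congr rfl fun p _ => Finset.sum_congr rfl fun q _ => by ring
    simp only [this, integral_const, probReal_univ, one_smul]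
  rw [Finset.sum_congr rfl fun p _ => Finset.sum_congr rfl fun q _ => hB p q] at hsum
  simp_rw [← Finset.mul_sum, Finset.sum_add_distrib] at hsum
  simp only [Finset.sum_const, Finset.card_univ, nsmul_eq_mul, mul_one, Finset.sum_ite_eq,
    Finset.mem_univ, if_true] at hsum
  have hval : quartic r.1 i i i i / 2 = ((Fintype.card I : ℂ) * (Fintype.card I + 1))⁻¹ := by
    apply eq_inv_of_mul_eq_one_left; linear_combination hsum
  rw [← hval, sum_units_int]
  simp only [pairing, if_true, show ((-1 : ℤˣ) = 1) = False from by decide, if_false]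
  by_cases h1 : i = k ∧ j = l
  · obtain ⟨rfl, rfl⟩ := h1
    have : (i = j ∧ j = i) ↔ i = j := ⟨fun h => h.1, fun h => ⟨h, h.symm⟩⟩
    rw [hB]; simp only [this, and_self, if_true]
  · by_cases h2 : i = l ∧ j = k
    · obtain ⟨rfl, rfl⟩ := h2
      have : quartic r.1 i j j i = quartic r.1 i j i j := by
        unfold quartic; congr 1; ext U; ring
      rw [this, hB]
      have hne : ¬ i = j := fun h => h1 ⟨h, h.symm⟩
      simp [hne]
    · rw [quartic_eq_zero r.1 h1 h2]; simp [h1, h2]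

/-- First moments of the projector on a Haar-random unit vector. -/
theorem quadratic_eq (r : UnitVec I) (i k : I) :
    ∫ U, randVec r.1 U i * star (randVec r.1 U k) ∂haarUnitary I =
      (Fintype.card I : ℂ)⁻¹ * if i = k then 1 else 0 := by
  -- Inserting 1 = Σⱼ |vⱼ|² reduces the first moment to the second.
  have h1 : ∫ U, randVec r.1 U i * star (randVec r.1 U k) ∂haarUnitary I =
      ∑ j, quartic r.1 i j k j := by
    unfold quartic
    rw [← integral_finsetSum _ fun j _ => integrable_of_continuous (continuous_quartic r.1 _ _ _ _)]
    congr 1; ext U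
    rw [← mul_one (randVec r.1 U i * _), ← sum_randVec_mul_star r U, Finset.mul_sum]
    exact Finset.sum_congr rfl fun j _ => by ring
  have hcard : (Fintype.card I : ℂ) ≠ 0 := by
    have : Nonempty I := ⟨i⟩
    exact_mod_cast Fintype.card_ne_zero
  have hcard' : (Fintype.card I : ℂ) + 1 ≠ 0 := Nat.cast_add_one_ne_zero _
  rw [h1]
  simp_rw [quartic_eq, ← Finset.mul_sum, sum_units_int, Finset.sum_add_distrib]
  simp only [pairing, if_true, show ((-1 : ℤˣ) = 1) = False from by decide, if_false, and_true]
  by_cases h : i = k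
  · subst h
    have : ∀ x, (i = x ∧ x = i) ↔ x = i := fun x => ⟨fun h => h.2, fun h => ⟨h.symm, h⟩⟩
    simp [this]
    field_simp
  · have : ∀ x, ¬ (i = x ∧ x = k) := fun x hx => h (hx.1.trans hx.2)
    simp [this, h]

end Haar

/-! ### Moments of amplitudes in a product of independent random vectors -/

section Moments

variable {V S : Type} [Fintype V] [DecidableEq V] [Fintype S] {I : V → Type} [∀ v, Fintype (I v)]
  [∀ v, DecidableEq (I v)]

theorem sum_mul_sum_four {α : Type*} [Fintype α] (f g h k : α → ℂ) :
    (∑ i, f i) * (∑ i, g i) * (∑ i, h i) * (∑ i, k i) =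
      ∑ m : α × α × α × α, f m.1 * g m.2.1 * h m.2.2.1 * k m.2.2.2 := by
  simp only [Fintype.sum_prod_type, ← Finset.mul_sum, ← Finset.sum_mul]

/-- The superposition, with coefficients `c`, of entries of a tensor product of the `Uᵥ rᵥ`. -/
def amplitude (r : ∀ v, UnitVec (I v)) (c : S → ℂ) (leg : S → ∀ v, I v)
    (U : ∀ v, Matrix.unitaryGroup (I v) ℂ) : ℂ :=
  ∑ s, c s * ∏ v, randVec (r v).1 (U v) (leg s v)

theorem integral_amplitude_pow_four (r : ∀ v, UnitVec (I v)) (c : S → ℂ) (leg : S → ∀ v, I v) :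
    ((∫ U, ‖amplitude r c leg U‖ ^ 4 ∂Measure.pi fun v => haarUnitary (I v) : ℝ) : ℂ) =
      (∏ v, ((Fintype.card (I v) : ℂ) * (Fintype.card (I v) + 1))⁻¹) *
        ∑ σ : V → ℤˣ, ∑ m : S × S × S × S, c m.1 * c m.2.1 * star (c m.2.2.1) * star (c m.2.2.2) *
          ∏ v, pairing (σ v) (leg m.1 v) (leg m.2.1 v) (leg m.2.2.1 v) (leg m.2.2.2 v) := by
  classical
  have hA : ∀ U, ((‖amplitude r c leg U‖ ^ 4 : ℝ) : ℂ) =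
      ∑ m : S × S × S × S, (c m.1 * c m.2.1 * star (c m.2.2.1) * star (c m.2.2.2)) *
        ∏ v, (randVec (r v).1 (U v) (leg m.1 v) * randVec (r v).1 (U v) (leg m.2.1 v) *
          star (randVec (r v).1 (U v) (leg m.2.2.1 v)) *
          star (randVec (r v).1 (U v) (leg m.2.2.2 v))) := by
    intro U
    have h4 : ∀ z : ℂ, ((‖z‖ ^ 4 : ℝ) : ℂ) = z * z * star z * star z := by
      intro z
      have : z * star z = ((‖z‖ ^ 2 : ℝ) : ℂ) := by push_cast; exact Complex.mul_conj' z
      calc ((‖z‖ ^ 4 : ℝ) : ℂ) = ((‖z‖ ^ 2 : ℝ) : ℂ) * ((‖z‖ ^ 2 : ℝ) : ℂ) := by push_cast; ring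
        _ = _ := by rw [← this]; ring
    rw [h4, amplitude, star_sum, sum_mul_sum_four]
    refine Finset.sum_congr rfl fun m _ => ?_
    simp only [Finset.prod_mul_distrib, star_mul', star_prod]
    ring
  rw [← integral_complex_ofReal]
  simp_rw [hA]
  have hint : ∀ m : S × S × S × S, Integrable (fun U : ∀ v, Matrix.unitaryGroup (I v) ℂ =>
      ∏ v, (randVec (r v).1 (U v) (leg m.1 v) * randVec (r v).1 (U v) (leg m.2.1 v) *
          star (randVec (r v).1 (U v) (leg m.2.2.1 v)) *
          star (randVec (r v).1 (U v) (leg m.2.2.2 v))))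
      (Measure.pi fun v => haarUnitary (I v)) := fun m =>
    Integrable.fintype_prod_dep
      (f := fun v u => randVec (r v).1 u (leg m.1 v) * randVec (r v).1 u (leg m.2.1 v) *
          star (randVec (r v).1 u (leg m.2.2.1 v)) * star (randVec (r v).1 u (leg m.2.2.2 v)))
      fun v => integrable_of_continuous (continuous_quartic _ _ _ _ _)
  rw [integral_finsetSum _ fun m _ => (hint m).const_mul _]
  simp_rw [integral_const_mul]
  have hq : ∀ m : S × S × S × S, ∫ U : ∀ v, Matrix.unitaryGroup (I v) ℂ,
      ∏ v, (randVec (r v).1 (U v) (leg m.1 v) * randVec (r v).1 (U v) (leg m.2.1 v) *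
          star (randVec (r v).1 (U v) (leg m.2.2.1 v)) *
          star (randVec (r v).1 (U v) (leg m.2.2.2 v))) ∂Measure.pi (fun v => haarUnitary (I v)) =
      (∏ v, ((Fintype.card (I v) : ℂ) * (Fintype.card (I v) + 1))⁻¹) *
        ∑ σ : V → ℤˣ, ∏ v, pairing (σ v) (leg m.1 v) (leg m.2.1 v) (leg m.2.2.1 v)
          (leg m.2.2.2 v) := by
    intro m
    rw [integral_fintype_prod_eq_prod
      (f := fun v u => randVec (r v).1 u (leg m.1 v) * randVec (r v).1 u (leg m.2.1 v) *
          star (randVec (r v).1 u (leg m.2.2.1 v)) * star (randVec (r v).1 u (leg m.2.2.2 v)))]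
    have := fun v => quartic_eq (r v) (leg m.1 v) (leg m.2.1 v) (leg m.2.2.1 v) (leg m.2.2.2 v)
    unfold quartic at this
    simp_rw [this, Finset.prod_mul_distrib]
    -- Distributing the product of two-term sums produces the sum over spin configurations.
    rw [Finset.prod_univ_sum, Fintype.piFinset_univ]
  simp_rw [hq]
  rw [Finset.sum_comm, Finset.mul_sum]
  refine Finset.sum_congr rfl fun m _ => ?_
  rw [← Finset.mul_sum]
  ring

/-- Distinct s, t have different indices at some vertex, by injectivity, and the first moment there
vanishes; only diagonal terms remain. -/
theorem integral_amplitude_sq (r : ∀ v, UnitVec (I v)) (c : S → ℂ) {leg : S → ∀ v, I v}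
    (hleg : Function.Injective leg) :
    Integrable (fun U => ‖amplitude r c leg U‖ ^ 2) (Measure.pi fun v => haarUnitary (I v)) ∧
    ∫ U, ‖amplitude r c leg U‖ ^ 2 ∂Measure.pi (fun v => haarUnitary (I v)) =
      (∏ v, (Fintype.card (I v) : ℝ)⁻¹) * ∑ s, ‖c s‖ ^ 2 := by
  classical
  have hA : ∀ U, ((‖amplitude r c leg U‖ ^ 2 : ℝ) : ℂ) =
      ∑ s, ∑ t, (c s * star (c t)) *
        ∏ v, (randVec (r v).1 (U v) (leg s v) * star (randVec (r v).1 (U v) (leg t v))) := by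
    intro U
    have : ∀ z : ℂ, ((‖z‖ ^ 2 : ℝ) : ℂ) = z * star z := by
      intro z; push_cast; exact (Complex.mul_conj' z).symm
    rw [this, amplitude, star_sum, Finset.sum_mul_sum]
    refine Finset.sum_congr rfl fun s _ => Finset.sum_congr rfl fun t _ => ?_
    simp only [Finset.prod_mul_distrib, star_mul', star_prod]
    ring
  have hint : ∀ s t : S, Integrable (fun U : ∀ v, Matrix.unitaryGroup (I v) ℂ =>
      ∏ v, (randVec (r v).1 (U v) (leg s v) * star (randVec (r v).1 (U v) (leg t v))))
      (Measure.pi fun v => haarUnitary (I v)) := fun s t =>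
    Integrable.fintype_prod_dep
      (f := fun v u => randVec (r v).1 u (leg s v) * star (randVec (r v).1 u (leg t v)))
      fun v => integrable_of_continuous
        ((continuous_randVec _ _).mul (continuous_randVec _ _).star)
  have hintA : Integrable (fun U => ((‖amplitude r c leg U‖ ^ 2 : ℝ) : ℂ))
      (Measure.pi fun v => haarUnitary (I v)) := by
    simp_rw [hA]
    exact integrable_finsetSum _ fun s _ => integrable_finsetSum _ fun t _ =>
      (hint s t).const_mul _
  refine ⟨by simpa only [RCLike.re_to_complex, Complex.ofReal_re] using hintA.re, ?_⟩
  apply Complex.ofReal_injective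
  rw [← integral_complex_ofReal]
  simp_rw [hA]
  rw [integral_finsetSum _ fun s _ => integrable_finsetSum _ fun t _ => (hint s t).const_mul _]
  simp_rw [integral_finsetSum _ fun t _ => (hint _ t).const_mul _, integral_const_mul]
  have hq : ∀ s t : S, ∫ U : ∀ v, Matrix.unitaryGroup (I v) ℂ,
      ∏ v, (randVec (r v).1 (U v) (leg s v) * star (randVec (r v).1 (U v) (leg t v)))
        ∂Measure.pi (fun v => haarUnitary (I v)) =
      (∏ v, (Fintype.card (I v) : ℂ)⁻¹) * if s = t then 1 else 0 := by
    intro s t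
    rw [integral_fintype_prod_eq_prod
      (f := fun v u => randVec (r v).1 u (leg s v) * star (randVec (r v).1 u (leg t v)))]
    simp_rw [quadratic_eq, Finset.prod_mul_distrib, Finset.prod_ite_zero, Finset.prod_const_one]
    congr 1
    refine if_congr ⟨fun h => hleg (funext fun v => h v (Finset.mem_univ v)), ?_⟩ rfl rfl
    rintro rfl v _; rfl
  simp_rw [hq]
  push_cast
  rw [Finset.mul_sum]
  refine Finset.sum_congr rfl fun s _ => ?_
  simp only [mul_ite, mul_one, mul_zero, Finset.sum_ite_eq, Finset.mem_univ, if_true]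
  rw [show c s * star (c s) = (‖c s‖ : ℂ) ^ 2 from Complex.mul_conj' (c s)]
  ring

end Moments

/-! ### Factorisation of pairings, and purities -/

section Pairing

theorem pairing_prod {α β : Type} [DecidableEq α] [DecidableEq β] (τ : ℤˣ) (i j k l : α × β) :
    pairing τ i j k l = pairing τ i.1 j.1 k.1 l.1 * pairing τ i.2 j.2 k.2 l.2 := by
  simp only [pairing, Prod.ext_iff]
  split_ifs <;> simp_all

theorem pairing_pi {ι α : Type} [Fintype ι] [DecidableEq α] [DecidableEq (ι → α)] (τ : ℤˣ)
    (i j k l : ι → α) :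
    pairing τ i j k l = ∏ x, pairing τ (i x) (j x) (k x) (l x) := by
  simp only [pairing]
  split_ifs with h1 h2 h3
  · simp [h2.1, h2.2]
  · rw [Finset.prod_ite_zero, if_neg]
    intro h; exact h2 ⟨funext fun x => (h x (Finset.mem_univ x)).1,
      funext fun x => (h x (Finset.mem_univ x)).2⟩
  · simp [h3.1, h3.2]
  · rw [Finset.prod_ite_zero, if_neg]
    intro h; exact h3 ⟨funext fun x => (h x (Finset.mem_univ x)).1,
      funext fun x => (h x (Finset.mem_univ x)).2⟩

variable {ι : Type} [Fintype ι] {k : ℕ}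

/-- The configuration which is `x` at the sites of spin `1` and `y` elsewhere. -/
def mix {α : Type} (σ : ι → ℤˣ) (x y : ι → α) : ι → α := fun i => if σ i = 1 then x i else y i

theorem prod_pairing {α : Type} [DecidableEq α] [DecidableEq (ι → α)] (σ : ι → ℤˣ)
    (x y z w : ι → α) :
    ∏ i, pairing (σ i) (x i) (y i) (z i) (w i) =
      if z = mix σ x y ∧ w = mix σ y x then 1 else 0 := by
  have : ∀ i, pairing (σ i) (x i) (y i) (z i) (w i) =
      if z i = mix σ x y i ∧ w i = mix σ y x i then 1 else 0 := by
    intro i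
    simp only [pairing, mix]
    split_ifs <;> simp_all
  simp_rw [this, Finset.prod_ite_zero, Finset.prod_const_one]
  refine if_congr ⟨fun h => ⟨funext fun i => (h i (Finset.mem_univ i)).1,
    funext fun i => (h i (Finset.mem_univ i)).2⟩, ?_⟩ rfl rfl
  rintro ⟨rfl, rfl⟩ i _; exact ⟨rfl, rfl⟩

variable [DecidableEq ι]

/-- The purity of the reduction of `|v⟩⟨v|` to the sites of spin `-1`. -/
def purity (σ : ι → ℤˣ) (v : (ι → Fin k) → ℂ) : ℂ :=
  ∑ m : (ι → Fin k) × (ι → Fin k) × (ι → Fin k) × (ι → Fin k),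
    star (v m.1) * star (v m.2.1) * v m.2.2.1 * v m.2.2.2 *
      ∏ i, pairing (σ i) (m.1 i) (m.2.1 i) (m.2.2.1 i) (m.2.2.2 i)

theorem purity_eq (σ : ι → ℤˣ) (v : (ι → Fin k) → ℂ) :
    purity σ v = ∑ p : (ι → Fin k) × (ι → Fin k),
      star (v p.1) * star (v p.2) * v (mix σ p.1 p.2) * v (mix σ p.2 p.1) := by
  simp only [purity, prod_pairing, Fintype.sum_prod_type]
  refine Finset.sum_congr rfl fun x _ => Finset.sum_congr rfl fun y _ => ?_
  simp [ite_and]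

/-- Exchanging x and y at the sites of spin -1 is an involution on pairs, hence permutes the terms
of a sum over pairs. -/
theorem mix_mix {α : Type} (σ : ι → ℤˣ) (x y : ι → α) : mix σ (mix σ x y) (mix σ y x) = x := by
  ext i; simp only [mix]; split_ifs <;> rfl

theorem sum_norm_sq_mul (v : UnitVec (ι → Fin k)) :
    ∑ p : (ι → Fin k) × (ι → Fin k), ‖v.1 p.1‖ ^ 2 * ‖v.1 p.2‖ ^ 2 = 1 := by
  have h : ∑ x, ‖v.1 x‖ ^ 2 = 1 := v.2
  simp only [Fintype.sum_prod_type, ← Finset.mul_sum, h, mul_one]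

/-- By 2st ≤ s² + t², each term is at most the mean of |v(x)v(y)|² and the same quantity after the
exchange; both sum to 1. -/
theorem norm_purity_le (σ : ι → ℤˣ) (v : UnitVec (ι → Fin k)) : ‖purity σ v.1‖ ≤ 1 := by
  rw [purity_eq]
  refine (norm_sum_le _ _).trans ?_
  let e : (ι → Fin k) × (ι → Fin k) ≃ (ι → Fin k) × (ι → Fin k) :=
    { toFun := fun p => (mix σ p.1 p.2, mix σ p.2 p.1)
      invFun := fun p => (mix σ p.1 p.2, mix σ p.2 p.1)
      left_inv := fun p => Prod.ext (mix_mix _ _ _) (mix_mix _ _ _)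
      right_inv := fun p => Prod.ext (mix_mix _ _ _) (mix_mix _ _ _) }
  have h2 : ∑ p : (ι → Fin k) × (ι → Fin k),
      ‖v.1 (mix σ p.1 p.2)‖ ^ 2 * ‖v.1 (mix σ p.2 p.1)‖ ^ 2 = 1 := by
    refine Eq.trans ?_ (sum_norm_sq_mul v)
    exact e.sum_comp fun p => ‖v.1 p.1‖ ^ 2 * ‖v.1 p.2‖ ^ 2
  calc _ ≤ ∑ p : (ι → Fin k) × (ι → Fin k), ((‖v.1 p.1‖ ^ 2 * ‖v.1 p.2‖ ^ 2) / 2 +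
        (‖v.1 (mix σ p.1 p.2)‖ ^ 2 * ‖v.1 (mix σ p.2 p.1)‖ ^ 2) / 2) := by
        refine Finset.sum_le_sum fun p _ => ?_
        simp only [norm_mul, norm_star]
        nlinarith [sq_nonneg (‖v.1 p.1‖ * ‖v.1 p.2‖ -
          ‖v.1 (mix σ p.1 p.2)‖ * ‖v.1 (mix σ p.2 p.1)‖)]
    _ = 1 := by
        rw [Finset.sum_add_distrib, ← Finset.sum_div, ← Finset.sum_div, sum_norm_sq_mul, h2]
        norm_num

/-- For a product vector the exchange of sites leaves v(x)v(y) unchanged, so the sum is the squared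
normalization. -/
theorem purity_of_isProductVec (σ : ι → ℤˣ) (v : UnitVec (ι → Fin k)) (hv : IsProductVec v.1) :
    purity σ v.1 = 1 := by
  obtain ⟨f, hf⟩ := hv
  have hmix : ∀ x y, v.1 (mix σ x y) * v.1 (mix σ y x) = v.1 x * v.1 y := by
    intro x y
    simp only [hf, ← Finset.prod_mul_distrib, mix]
    refine Finset.prod_congr rfl fun i _ => ?_
    split_ifs
    · rfl
    · ring
  rw [purity_eq]
  refine Eq.trans ?_ ((congrArg Complex.ofReal (sum_norm_sq_mul v)).trans Complex.ofReal_one)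
  push_cast
  refine Finset.sum_congr rfl fun p _ => ?_
  rw [mul_assoc, hmix, ← Complex.mul_conj', ← Complex.mul_conj']
  simp only [Complex.star_def]
  ring

end Pairing

/-! ### Inverse effective dimension of a general network -/

section Network

variable {V E X : Type} [Fintype V] [DecidableEq V] [Fintype E] [DecidableEq E] [Fintype X]
  [DecidableEq X] {G : Graph V E X} {a b d : ℕ}

/-- The weight of a spin configuration: one factor `c` for each edge between unequal spins. -/
def Graph.weight (G : Graph V E X) (c : ℝ) (σ : V → ℤˣ) : ℝ :=
  ∏ e, if σ (G.src e) = σ (G.tgt e) then 1 else c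

/-- The value of the inverse effective dimension for product states. -/
def Graph.bound (G : Graph V E X) (a b d : ℕ) : ℝ :=
  (∑ σ, G.weight (b : ℝ)⁻¹ σ) / ((a : ℝ) ^ Fintype.card X *
    ∏ v, (1 + 1 / (Fintype.card (G.Leg a b d v) : ℝ)))

theorem Graph.weight_nonneg (G : Graph V E X) {c : ℝ} (hc : 0 ≤ c) (σ : V → ℤˣ) :
    0 ≤ G.weight c σ :=
  Finset.prod_nonneg fun e _ => by split_ifs <;> [exact zero_le_one; exact hc]

/-- The sum over the indices of the edges. -/
def Graph.edgeSum (G : Graph V E X) (b : ℕ) (σ : V → ℤˣ) : ℂ :=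
  ∑ m : (E → Fin b) × (E → Fin b) × (E → Fin b) × (E → Fin b),
    ∏ h : E × Bool, pairing (σ (G.endpoint h)) (m.1 h.1) (m.2.1 h.1) (m.2.2.1 h.1) (m.2.2.2 h.1)

/-- Equal spins leave two free indices, hence b²; unequal spins force all four indices to agree,
hence b. -/
theorem sum_pairing_mul_pairing (b : ℕ) (hb : 1 ≤ b) (τ τ' : ℤˣ) :
    ∑ k : Fin b × Fin b × Fin b × Fin b, pairing τ k.1 k.2.1 k.2.2.1 k.2.2.2 *
      pairing τ' k.1 k.2.1 k.2.2.1 k.2.2.2 = (b : ℂ) ^ 2 * if τ = τ' then 1 else (b : ℂ)⁻¹ := by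
  have hb' : (b : ℂ) ≠ 0 := by exact_mod_cast (by omega : b ≠ 0)
  have h1 : ∀ k : Fin b × Fin b × Fin b × Fin b, pairing 1 k.1 k.2.1 k.2.2.1 k.2.2.2 =
      if k.1 = k.2.2.1 then (if k.2.1 = k.2.2.2 then 1 else 0) else 0 := by
    intro k; simp [pairing, ite_and]
  have h2 : ∀ k : Fin b × Fin b × Fin b × Fin b, pairing (-1) k.1 k.2.1 k.2.2.1 k.2.2.2 =
      if k.2.1 = k.2.2.1 then (if k.1 = k.2.2.2 then 1 else 0) else 0 := by
    intro k; simp only [pairing, show ((-1 : ℤˣ) = 1) = False from by decide, if_false, ite_and]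
    split_ifs <;> rfl
  have hne : ((-1 : ℤˣ) = 1) = False := by decide
  have hne' : ((1 : ℤˣ) = -1) = False := by decide
  rcases Int.units_eq_one_or τ with rfl | rfl <;> rcases Int.units_eq_one_or τ' with rfl | rfl <;>
    simp only [h1, h2, Fintype.sum_prod_type, hne, hne', if_true, if_false]
  · simp; ring
  · simp [Finset.sum_ite_eq]; field_simp
  · simp; field_simp
  · simp; ring

theorem Graph.edgeSum_eq (hb : 1 ≤ b) (σ : V → ℤˣ) :
    G.edgeSum b σ = (((b : ℝ) ^ 2) ^ Fintype.card E * G.weight (b : ℝ)⁻¹ σ : ℝ) := by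
  have h : ∀ e, ∑ k : Fin b × Fin b × Fin b × Fin b,
      pairing (σ (G.src e)) k.1 k.2.1 k.2.2.1 k.2.2.2 *
      pairing (σ (G.tgt e)) k.1 k.2.1 k.2.2.1 k.2.2.2 =
      (((b : ℝ) ^ 2 * if σ (G.src e) = σ (G.tgt e) then 1 else (b : ℝ)⁻¹ : ℝ) : ℂ) := by
    intro e
    rw [sum_pairing_mul_pairing b hb]
    split_ifs <;> simp
  have hR : ((b : ℝ) ^ 2) ^ Fintype.card E * G.weight (b : ℝ)⁻¹ σ =
      ∏ e, ((b : ℝ) ^ 2 * if σ (G.src e) = σ (G.tgt e) then 1 else (b : ℝ)⁻¹) := by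
    rw [Finset.prod_mul_distrib, Finset.prod_const, Finset.card_univ, Graph.weight]
  rw [hR, Complex.ofReal_prod]
  simp_rw [← h]
  rw [Finset.prod_univ_sum, Fintype.piFinset_univ, Graph.edgeSum]
  -- Four index functions on the edges are regarded as one quadruple per edge.
  refine Fintype.sum_equiv
    { toFun := fun m e => (m.1 e, m.2.1 e, m.2.2.1 e, m.2.2.2 e)
      invFun := fun f => (fun e => (f e).1, fun e => (f e).2.1, fun e => (f e).2.2.1,
        fun e => (f e).2.2.2)
      left_inv := fun m => rfl
      right_inv := fun f => rfl } _ _ fun m => ?_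
  rw [Fintype.prod_prod_type]
  refine Finset.prod_congr rfl fun e _ => ?_
  simp [Graph.endpoint, mul_comm]

/-- The indices that a configuration of the edges induces at the vertices. -/
def Graph.legIndex (G : Graph V E X) (s : (X → Fin a) × (V → Fin d) × (E → Fin b)) (v : V) :
    G.Leg a b d v :=
  (fun i => s.1 i.1, s.2.1 v, fun h => s.2.2 h.1.1)

/-- Used to regroup a product over vertices and their legs as one over all sites or half-edges; a
self-loop contributes both of its halves. -/
theorem prod_fiber {α : Type} [Fintype α] [DecidableEq α] (p : α → V) (f : V → α → ℂ) :
    ∏ v, ∏ i : {i : α // p i = v}, f v i.1 = ∏ i, f (p i) i := by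
  rw [← Fintype.prod_sigma' (fun v (i : {i : α // p i = v}) => f v i.1)]
  refine Fintype.prod_equiv (Equiv.sigmaFiberEquiv p) _ _ ?_
  rintro ⟨v, i, rfl⟩; rfl

theorem Graph.prod_pairing_legIndex (G : Graph V E X) (σ : V → ℤˣ)
    (s t u w : (X → Fin a) × (V → Fin d) × (E → Fin b)) :
    ∏ v, pairing (σ v) (G.legIndex s v) (G.legIndex t v) (G.legIndex u v) (G.legIndex w v) =
      (∏ x, pairing (σ (G.site x)) (s.1 x) (t.1 x) (u.1 x) (w.1 x)) *
      ((∏ v, pairing (σ v) (s.2.1 v) (t.2.1 v) (u.2.1 v) (w.2.1 v)) *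
      ∏ h : E × Bool, pairing (σ (G.endpoint h)) (s.2.2 h.1) (t.2.2 h.1) (u.2.2 h.1)
        (w.2.2 h.1)) := by
  simp_rw [pairing_prod, pairing_pi, Finset.prod_mul_distrib, Graph.legIndex]
  rw [prod_fiber G.site fun v x => pairing (σ v) (s.1 x) (t.1 x) (u.1 x) (w.1 x),
    prod_fiber G.endpoint fun v h => pairing (σ v) (s.2.2 h.1) (t.2.2 h.1) (u.2.2 h.1)
        (w.2.2 h.1)]

theorem sum_four_prod {α β : Type} [Fintype α] [Fintype β] (f : α × α × α × α → ℂ)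
    (g : β × β × β × β → ℂ) :
    ∑ m : (α × β) × (α × β) × (α × β) × (α × β),
      f (m.1.1, m.2.1.1, m.2.2.1.1, m.2.2.2.1) * g (m.1.2, m.2.1.2, m.2.2.1.2, m.2.2.2.2) =
    (∑ m, f m) * ∑ m, g m := by
  rw [Finset.sum_mul_sum, ← Fintype.sum_prod_type']
  exact Fintype.sum_equiv
    { toFun := fun m => ((m.1.1, m.2.1.1, m.2.2.1.1, m.2.2.2.1),
        (m.1.2, m.2.1.2, m.2.2.1.2, m.2.2.2.2))
      invFun := fun m => ((m.1.1, m.2.1), (m.1.2.1, m.2.2.1), (m.1.2.2.1, m.2.2.2.1),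
        (m.1.2.2.2, m.2.2.2.2))
      left_inv := fun m => rfl
      right_inv := fun m => rfl } _ _ fun m => rfl

namespace States

variable (S : States G a b d)

/-- Conjugating the overlap makes it linear in the random tensors without changing its norm. -/
theorem norm_overlap (U : ∀ v, Matrix.unitaryGroup (G.Leg a b d v) ℂ) :
    ‖∑ x, star (S.psi U x) * S.bdy.1 x‖ =
      ‖amplitude S.ref (fun s : (X → Fin a) × (V → Fin d) × (E → Fin b) =>
        star (S.bdy.1 s.1) * star (S.bulk.1 s.2.1)) G.legIndex U‖ := by
  rw [← norm_star, star_sum]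
  congr 1
  simp only [amplitude, Fintype.sum_prod_type, star_mul', star_star, psi, Finset.sum_mul]
  refine Finset.sum_congr rfl fun x _ => Finset.sum_congr rfl fun l _ =>
    Finset.sum_congr rfl fun β _ => ?_
  simp only [randVec, Graph.legIndex]
  ring

theorem integral_overlap (hb : 1 ≤ b) :
    ((∫ U, ‖∑ x, star (S.psi U x) * S.bdy.1 x‖ ^ 4 ∂S.law : ℝ) : ℂ) =
      (∏ v, ((Fintype.card (G.Leg a b d v) : ℂ) * (Fintype.card (G.Leg a b d v) + 1))⁻¹) *
        ∑ σ : V → ℤˣ, purity (σ ∘ G.site) S.bdy.1 * (purity σ S.bulk.1 *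
          (((b : ℝ) ^ 2) ^ Fintype.card E * G.weight (b : ℝ)⁻¹ σ : ℝ)) := by
  simp_rw [norm_overlap, law, integral_amplitude_pow_four, Graph.prod_pairing_legIndex]
  congr 1
  refine Finset.sum_congr rfl fun σ _ => ?_
  rw [← G.edgeSum_eq hb, purity, purity, Graph.edgeSum, ← sum_four_prod, ← sum_four_prod]
  refine Finset.sum_congr rfl fun m _ => ?_
  simp only [star_mul', star_star, Function.comp]
  ring

theorem integral_norm_sq :
    ∫ U, ∑ x, ‖S.psi U x‖ ^ 2 ∂S.law =
      (∏ v, (Fintype.card (G.Leg a b d v) : ℝ)⁻¹) *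
        ((a : ℝ) ^ Fintype.card X * (b : ℝ) ^ Fintype.card E) := by
  have hpsi : ∀ U x, S.psi U x = amplitude S.ref
      (fun s : (V → Fin d) × (E → Fin b) => star (S.bulk.1 s.1)) (fun s => G.legIndex (x, s)) U := by
    intro U x
    simp only [psi, amplitude, Fintype.sum_prod_type]
    rfl
  -- The logical index is read off at v, and the index of an edge off its half at the source.
  have hinj : ∀ x : X → Fin a, Function.Injective fun s : (V → Fin d) × (E → Fin b) =>
      G.legIndex (x, s) := by
    intro x s t hst
    refine Prod.ext (funext fun v => ?_) (funext fun e => ?_)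
    · exact congrArg (fun p => p.2.1) (congrFun hst v)
    · exact congrFun (congrArg (fun p => p.2.2) (congrFun hst (G.src e))) ⟨(e, false), rfl⟩
  simp_rw [hpsi, law]
  rw [integral_finsetSum _ fun x _ => (integral_amplitude_sq _ _ (hinj x)).1]
  simp_rw [fun x => (integral_amplitude_sq S.ref (fun s : (V → Fin d) × (E → Fin b) =>
    star (S.bulk.1 s.1)) (hinj x)).2]
  have h : ∑ x, ‖S.bulk.1 x‖ ^ 2 = 1 := S.bulk.2
  simp only [norm_star, Fintype.sum_prod_type, Finset.sum_const, Finset.card_univ,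
    nsmul_eq_mul, ← Finset.mul_sum, h]
  simp
  ring

/-- Per vertex, (D (D + 1))⁻¹ divided by D⁻² is (1 + 1/D)⁻¹. The edge factor b² cancels against the
squared mean norm, and one power of a per site remains. -/
theorem invEffDim_eq_sum_purity (ha : 1 ≤ a) (hb : 1 ≤ b) (hd : 1 ≤ d) :
    (S.invEffDim : ℂ) = (1 / ((a : ℝ) ^ Fintype.card X *
      ∏ v, (1 + 1 / (Fintype.card (G.Leg a b d v) : ℝ))) : ℝ) *
      ∑ σ : V → ℤˣ, purity (σ ∘ G.site) S.bdy.1 * purity σ S.bulk.1 *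
        (G.weight (b : ℝ)⁻¹ σ : ℂ) := by
  have : Nonempty (Fin a) := ⟨⟨0, ha⟩⟩
  have : Nonempty (Fin b) := ⟨⟨0, hb⟩⟩
  have : Nonempty (Fin d) := ⟨⟨0, hd⟩⟩
  have ha' : (a : ℂ) ≠ 0 := by exact_mod_cast (by omega : a ≠ 0)
  have hb' : (b : ℂ) ≠ 0 := by exact_mod_cast (by omega : b ≠ 0)
  have hD : ∀ v, (Fintype.card (G.Leg a b d v) : ℂ) ≠ 0 :=
    fun v => by exact_mod_cast Fintype.card_ne_zero
  rw [invEffDim, Complex.ofReal_div, Complex.ofReal_mul, S.integral_overlap hb,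
    S.integral_norm_sq]
  push_cast
  have e1 : ∀ v, (1 + 1 / (Fintype.card (G.Leg a b d v) : ℂ)) =
      (Fintype.card (G.Leg a b d v) + 1) * (Fintype.card (G.Leg a b d v) : ℂ)⁻¹ := by
    intro v; have := hD v; field_simp
  simp_rw [e1, Finset.prod_inv_distrib, Finset.prod_mul_distrib, Finset.prod_inv_distrib]
  have hP : ∏ v, (Fintype.card (G.Leg a b d v) : ℂ) ≠ 0 := Finset.prod_ne_zero_iff.2 fun v _ => hD v
  have hP1 : ∏ v, ((Fintype.card (G.Leg a b d v) : ℂ) + 1) ≠ 0 :=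
    Finset.prod_ne_zero_iff.2 fun v _ => Nat.cast_add_one_ne_zero _
  have e2 : ∀ σ : V → ℤˣ, purity (σ ∘ G.site) S.bdy.1 * (purity σ S.bulk.1 *
      (((b : ℂ) ^ 2) ^ Fintype.card E * (G.weight (b : ℝ)⁻¹ σ : ℂ))) =
      ((b : ℂ) ^ 2) ^ Fintype.card E * (purity (σ ∘ G.site) S.bdy.1 * purity σ S.bulk.1 *
        (G.weight (b : ℝ)⁻¹ σ : ℂ)) := fun σ => by ring
  simp_rw [e2, ← Finset.mul_sum]
  field_simp
  ring

theorem invEffDim_nonneg : 0 ≤ S.invEffDim := by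
  unfold invEffDim
  refine div_nonneg (mul_nonneg (by positivity) (integral_nonneg fun U => by positivity))
    (by positivity)

theorem invEffDim_le (ha : 1 ≤ a) (hb : 1 ≤ b) (hd : 1 ≤ d) : S.invEffDim ≤ G.bound a b d := by
  have h0 : 0 ≤ 1 / ((a : ℝ) ^ Fintype.card X *
      ∏ v, (1 + 1 / (Fintype.card (G.Leg a b d v) : ℝ))) :=
    div_nonneg zero_le_one (mul_nonneg (by positivity) (Finset.prod_nonneg fun v _ => by positivity))
  have h1 : S.invEffDim = ‖(S.invEffDim : ℂ)‖ := by
    rw [Complex.norm_real, Real.norm_of_nonneg S.invEffDim_nonneg]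
  rw [h1, S.invEffDim_eq_sum_purity ha hb hd, norm_mul, Complex.norm_real, Real.norm_of_nonneg h0,
    Graph.bound, ← one_div_mul_eq_div _ (∑ σ, G.weight (b : ℝ)⁻¹ σ)]
  refine mul_le_mul_of_nonneg_left ?_ h0
  refine (norm_sum_le _ _).trans (Finset.sum_le_sum fun σ _ => ?_)
  have hw := G.weight_nonneg (inv_nonneg.2 (Nat.cast_nonneg b)) σ
  rw [norm_mul, norm_mul, Complex.norm_real, Real.norm_of_nonneg hw]
  refine mul_le_of_le_one_left hw ?_
  exact mul_le_one₀ (norm_purity_le _ _) (norm_nonneg _) (norm_purity_le _ _)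

theorem invEffDim_eq (ha : 1 ≤ a) (hb : 1 ≤ b) (hd : 1 ≤ d) (hS : S.Unentangled) :
    S.invEffDim = G.bound a b d := by
  apply Complex.ofReal_injective
  rw [S.invEffDim_eq_sum_purity ha hb hd, Graph.bound]
  simp_rw [purity_of_isProductVec _ _ hS.1, purity_of_isProductVec _ _ hS.2]
  push_cast
  simp only [one_mul]
  exact one_div_mul_eq_div _ _

end States

end Network

/-! ### Ising sums and the transfer matrix -/

section Ising

variable {V E X : Type} [Fintype V] [DecidableEq V] [Fintype E] [DecidableEq E] [Fintype X]
  [DecidableEq X] {G : Graph V E X} {a b d : ℕ}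

theorem Graph.isingZ_eq_sum_weight (G : Graph V E X) (hb : 1 ≤ b) :
    G.isingZ (Real.log (Real.sqrt b)) = ∑ σ, G.weight (b : ℝ)⁻¹ σ := by
  have hb' : (0 : ℝ) < b := by exact_mod_cast hb
  rw [Graph.isingZ, Finset.mul_sum]
  refine Finset.sum_congr rfl fun σ _ => ?_
  rw [one_div, ← Real.exp_neg, ← Real.exp_add, ← Finset.sum_neg_distrib, ← Finset.sum_add_distrib,
    Real.exp_sum, Graph.weight]
  refine Finset.prod_congr rfl fun e _ => ?_
  -- Relative to an aligned edge, an unequal pair costs e^(-2J), which is 1/b at J = log √b.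
  have hexp : Real.exp (-Real.log (Real.sqrt b) + -Real.log (Real.sqrt b)) = (b : ℝ)⁻¹ := by
    rw [Real.log_sqrt hb'.le, ← neg_add, add_halves, Real.exp_neg, Real.exp_log hb']
  rcases Int.units_eq_one_or (σ (G.src e)) with h | h <;>
    rcases Int.units_eq_one_or (σ (G.tgt e)) with h' | h' <;> rw [h, h']
  · simp
  · rw [if_neg (by decide), ← hexp]; simp
  · rw [if_neg (by decide), ← hexp]; simp
  · simp

theorem Graph.weight_le_one (G : Graph V E X) {c : ℝ} (hc : 0 ≤ c) (hc1 : c ≤ 1) (σ : V → ℤˣ) :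
    G.weight c σ ≤ 1 :=
  Finset.prod_le_one (fun e _ => by split_ifs <;> [exact zero_le_one; exact hc])
    fun e _ => by split_ifs <;> [exact le_rfl; exact hc1]

theorem Graph.bound_le (G : Graph V E X) (ha : 1 ≤ a) (hb : 1 ≤ b) (d : ℕ) :
    G.bound a b d ≤ 2 ^ Fintype.card V / (a : ℝ) ^ Fintype.card X := by
  have ha' : (0 : ℝ) < a := by exact_mod_cast ha
  have hb' : (1 : ℝ) ≤ b := by exact_mod_cast hb
  have h1 : ∑ σ, G.weight (b : ℝ)⁻¹ σ ≤ 2 ^ Fintype.card V := by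
    calc ∑ σ, G.weight (b : ℝ)⁻¹ σ ≤ ∑ _σ : V → ℤˣ, (1 : ℝ) :=
          Finset.sum_le_sum fun σ _ => G.weight_le_one (by positivity) (inv_le_one_of_one_le₀ hb') σ
      _ = _ := by simp
  refine div_le_div₀ (by positivity) h1 (by positivity) (le_mul_of_one_le_right (by positivity) ?_)
  calc (1 : ℝ) = ∏ _v : V, (1 : ℝ) := by simp
    _ ≤ _ := Finset.prod_le_prod (fun _ _ => zero_le_one) fun v _ =>
      le_add_of_nonneg_right (by positivity)

/-- The weight of a pair of neighbouring spins. -/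
def link (c : ℝ) (s t : ℤˣ) : ℝ := if s = t then 1 else c

/-- The transfer matrix method for the open Ising chain of `n + 1` spins. -/
theorem sum_prod_link (c : ℝ) : ∀ (n : ℕ) (h : ℤˣ → ℤˣ → ℝ),
    ∑ σ : Fin (n + 1) → ℤˣ, (∏ e : Fin n, link c (σ e.castSucc) (σ e.succ)) *
      h (σ 0) (σ (Fin.last n)) =
    ∑ s : ℤˣ, ∑ t : ℤˣ, h s t * (((1 + c) ^ n + ((s * t : ℤˣ) : ℤ) * (1 - c) ^ n) / 2)
  | 0, h => by
    rw [← (Equiv.funUnique (Fin 1) ℤˣ).symm.sum_comp]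
    simp
  | n + 1, h => by
    rw [← (Fin.consEquiv fun _ => ℤˣ).sum_comp, Fintype.sum_prod_type, Finset.sum_comm]
    -- Summing out the first spin replaces h by its contraction with the transfer matrix; the
    -- induction needs h arbitrary for this.
    have := sum_prod_link c n fun s t => ∑ s', link c s' s * h s' t
    have e : ∀ σ : Fin (n + 1) → ℤˣ, ∑ s : ℤˣ,
        (∏ e : Fin (n + 1), link c ((Fin.consEquiv fun _ => ℤˣ) (s, σ) e.castSucc)
          ((Fin.consEquiv fun _ => ℤˣ) (s, σ) e.succ)) *
          h ((Fin.consEquiv fun _ => ℤˣ) (s, σ) 0)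
            ((Fin.consEquiv fun _ => ℤˣ) (s, σ) (Fin.last (n + 1))) =
        (∏ e : Fin n, link c (σ e.castSucc) (σ e.succ)) *
          ∑ s', link c s' (σ 0) * h s' (σ (Fin.last n)) := by
      intro σ
      rw [Finset.mul_sum]
      refine Finset.sum_congr rfl fun s _ => ?_
      rw [Fin.prod_univ_succ]
      simp only [Fin.consEquiv_apply, Fin.castSucc_zero, Fin.cons_zero, Fin.cons_succ,
        ← Fin.succ_castSucc, ← Fin.succ_last]
      ring
    simp_rw [e]
    rw [this]
    simp only [sum_units_int, link, show ((-1 : ℤˣ) = 1) = False from by decide,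
      show ((1 : ℤˣ) = -1) = False from by decide, if_true, if_false]
    push_cast
    ring

end Ising

/-! ### Closed forms for open and closed chains -/

section Train

theorem sum_weight_open (c : ℝ) {n : ℕ} (hn : 1 ≤ n) :
    ∑ σ, (train .opn n).weight c σ = 2 * (1 + c) ^ (n - 1) := by
  obtain ⟨m, rfl⟩ := Nat.exists_eq_add_of_le' hn
  have := sum_prod_link c m fun _ _ => 1
  simp only [mul_one] at this
  refine Eq.trans (Finset.sum_congr rfl fun σ _ => rfl) (this.trans ?_)
  simp
  ring

theorem sum_weight_closed (c : ℝ) {n : ℕ} (hn : 1 ≤ n) :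
    ∑ σ, (train .closed n).weight c σ = (1 + c) ^ n + (1 - c) ^ n := by
  obtain ⟨m, rfl⟩ := Nat.exists_eq_add_of_le' hn
  -- The boundary function is the closing edge from last to first spin, so the sum is a trace; m = 0
  -- is the self-loop.
  have := sum_prod_link c m fun s t => link c t s
  refine Eq.trans (Finset.sum_congr rfl fun σ _ => ?_) (this.trans ?_)
  · refine (Fin.prod_univ_castSucc _).trans ?_
    congr 1
    · refine Finset.prod_congr rfl fun e _ => ?_
      have : (train .closed (m + 1)).tgt e.castSucc = e.succ := by
        apply Fin.ext
        simp only [train, Fin.val_castSucc, Fin.val_succ]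
        exact Nat.mod_eq_of_lt (by omega)
      rw [this]; rfl
    · have : (train .closed (m + 1)).tgt (Fin.last m) = (0 : Fin (m + 1)) := by
        apply Fin.ext
        simp [train]
      rw [this]; rfl
  · simp only [sum_units_int, link, show ((-1 : ℤˣ) = 1) = False from by decide,
      show ((1 : ℤˣ) = -1) = False from by decide, if_true, if_false]
    push_cast
    ring

theorem card_endpoint {V E X : Type} [DecidableEq V] [Fintype E] (G : Graph V E X) (v : V) :
    Fintype.card {h : E × Bool // G.endpoint h = v} =
      (∑ e, if G.src e = v then 1 else 0) + ∑ e, if G.tgt e = v then 1 else 0 := by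
  rw [Fintype.card_subtype, Finset.card_filter, Fintype.sum_prod_type, ← Finset.sum_add_distrib]
  refine Finset.sum_congr rfl fun e _ => ?_
  simp only [Fintype.sum_bool, Graph.endpoint, if_true, Bool.false_eq_true, if_false]
  rw [add_comm]

theorem card_leg_train (bc : BC) (n a b d : ℕ) (v : Fin n) :
    Fintype.card ((train bc n).Leg a b d v) =
      a * d * b ^ Fintype.card {h // (train bc n).endpoint h = v} := by
  have : Fintype.card {x // (train bc n).site x = v} = 1 := by
    cases bc <;> exact Fintype.card_eq_one_iff.2 ⟨⟨v, rfl⟩, fun y => Subtype.ext y.2⟩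
  simp only [Fintype.card_prod, Fintype.card_fun, Fintype.card_fin, this, pow_one, mul_assoc]

/-- The cyclic shift is a bijection, so each vertex is the source of one edge and the target of one,
also for one or two vertices. -/
theorem card_endpoint_closed {n : ℕ} (v : Fin n) :
    Fintype.card {h // (train .closed n).endpoint h = v} = 2 := by
  obtain ⟨m, rfl⟩ := Nat.exists_eq_succ_of_ne_zero v.pos.ne'
  rw [card_endpoint]
  have h2 : ∀ e : Fin (m + 1), (train .closed (m + 1)).tgt e = e + 1 := by
    intro e
    apply Fin.ext
    simp [train, Fin.val_add]
  have h3 : ∀ e : Fin (m + 1), e + 1 = v ↔ e = v - 1 := fun e => eq_sub_iff_add_eq.symm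
  change (∑ e : Fin (m + 1), if e = v then 1 else 0) +
    (∑ e : Fin (m + 1), if (train .closed (m + 1)).tgt e = v then 1 else 0) = 2
  simp_rw [h2, h3]
  simp

theorem card_endpoint_open {m : ℕ} (v : Fin (m + 2)) :
    Fintype.card {h // (train .opn (m + 2)).endpoint h = v} =
      (∑ e : Fin (m + 1), if e.castSucc = v then 1 else 0) +
        ∑ e : Fin (m + 1), if e.succ = v then 1 else 0 :=
  card_endpoint _ v

theorem bound_open {n : ℕ} (hn : 2 ≤ n) (a b d : ℕ) :
    (train .opn n).bound a b d = 2 * (1 + 1 / (b : ℝ)) ^ (n - 1) /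
        ((a : ℝ) ^ n * (1 + 1 / ((a : ℝ) * d * b)) ^ 2 *
          (1 + 1 / ((a : ℝ) * d * (b : ℝ) ^ 2)) ^ (n - 2)) := by
  obtain ⟨m, rfl⟩ := Nat.exists_eq_add_of_le' hn
  rw [Graph.bound, sum_weight_open _ (by omega)]
  simp_rw [card_leg_train]
  -- The two end vertices, distinct as n ≥ 2, have a single bond leg and are split off.
  rw [Fin.prod_univ_succ, Fin.prod_univ_castSucc]
  have h0 : Fintype.card {h // (train .opn (m + 2)).endpoint h = 0} = 1 := by
    rw [card_endpoint_open]
    have : ∀ e : Fin (m + 1), e.castSucc = 0 ↔ e = 0 := fun e => Fin.castSucc_eq_zero_iff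
    simp [this, Fin.succ_ne_zero]
  have hl : Fintype.card {h // (train .opn (m + 2)).endpoint h = (Fin.last m).succ} = 1 := by
    rw [card_endpoint_open]
    simp [Fin.castSucc_ne_last]
  have hm : ∀ j : Fin m,
      Fintype.card {h // (train .opn (m + 2)).endpoint h = j.castSucc.succ} = 2 := by
    intro j
    rw [card_endpoint_open]
    have : ∀ e : Fin (m + 1), e.castSucc = j.castSucc.succ ↔ e = j.succ := by
      intro e; rw [Fin.succ_castSucc, Fin.castSucc_inj]
    simp [this]
  simp_rw [hm, h0, hl]
  simp only [Fintype.card_fin, Finset.prod_const, Finset.card_univ, one_div, Nat.add_sub_cancel]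
  push_cast
  ring

theorem bound_closed {n : ℕ} (hn : 1 ≤ n) (a b d : ℕ) :
    (train .closed n).bound a b d = ((1 + 1 / (b : ℝ)) ^ n + (1 - 1 / (b : ℝ)) ^ n) /
        ((a : ℝ) ^ n * (1 + 1 / ((a : ℝ) * d * (b : ℝ) ^ 2)) ^ n) := by
  rw [Graph.bound, sum_weight_closed _ hn]
  simp_rw [card_leg_train, card_endpoint_closed]
  simp only [Fintype.card_fin, Finset.prod_const, Finset.card_univ, one_div]
  push_cast
  rfl

end Train

/-! ### Exponential decay and limits -/

section Limits

/-- The factor by which the inverse effective dimension decreases with each further site. -/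
def rate (a b d : ℕ) : ℝ :=
  (1 + 1 / (b : ℝ)) / (a * (1 + 1 / ((a : ℝ) * d * (b : ℝ) ^ 2)))

theorem rate_nonneg (a b d : ℕ) : 0 ≤ rate a b d := by unfold rate; positivity

theorem bound_train_le (bc : BC) {n a b d : ℕ} (hn : 2 ≤ n) (ha : 1 ≤ a) (hb : 1 ≤ b)
    (hd : 1 ≤ d) : (train bc n).bound a b d ≤ 2 * rate a b d ^ n := by
  have ha' : (0 : ℝ) < a := by exact_mod_cast ha
  have hd' : (0 : ℝ) < d := by exact_mod_cast hd
  have hb' : (1 : ℝ) ≤ b := by exact_mod_cast hb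
  have hb0 : (0 : ℝ) < b := by linarith
  rw [rate, div_pow, mul_pow, ← mul_div_assoc]
  have hi : 1 / (b : ℝ) ≤ 1 := by rw [div_le_one hb0]; exact hb'
  have hi0 : 0 ≤ 1 / (b : ℝ) := by positivity
  cases bc
  · rw [bound_open hn]
    refine div_le_div₀ (by positivity) ?_ (by positivity) ?_
    · exact mul_le_mul_of_nonneg_left
        (pow_le_pow_right₀ (le_add_of_nonneg_right hi0) (Nat.sub_le n 1)) zero_le_two
    · have hw : 1 + 1 / ((a : ℝ) * d * (b : ℝ) ^ 2) ≤ 1 + 1 / ((a : ℝ) * d * b) := by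
        gcongr
        nlinarith
      calc (a : ℝ) ^ n * (1 + 1 / ((a : ℝ) * d * (b : ℝ) ^ 2)) ^ n
          = (a : ℝ) ^ n * (1 + 1 / ((a : ℝ) * d * (b : ℝ) ^ 2)) ^ 2 *
            (1 + 1 / ((a : ℝ) * d * (b : ℝ) ^ 2)) ^ (n - 2) := by
            rw [mul_assoc ((a : ℝ) ^ n), ← pow_add, Nat.add_sub_cancel' hn]
        _ ≤ _ := by gcongr
  · rw [bound_closed (by omega)]
    refine div_le_div_of_nonneg_right ?_ (by positivity)
    rw [two_mul]
    gcongr; linarith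

/-- 1 + 1/b ≤ 2 ≤ a < a + 1/(d b²); the last term gives strictness even at a = 2, b = 1. -/
theorem rate_lt_one {a b d : ℕ} (ha : 2 ≤ a) (hb : 1 ≤ b) (hd : 1 ≤ d) : rate a b d < 1 := by
  have ha' : (2 : ℝ) ≤ a := by exact_mod_cast ha
  have hd' : (0 : ℝ) < d := by exact_mod_cast hd
  have hb' : (1 : ℝ) ≤ b := by exact_mod_cast hb
  have hb0 : (0 : ℝ) < b := by linarith
  have ha0 : (0 : ℝ) < a := by linarith
  have hi : 1 / (b : ℝ) ≤ 1 := by rw [div_le_one hb0]; exact hb'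
  have hx : 0 < (a : ℝ) * (1 / ((a : ℝ) * d * (b : ℝ) ^ 2)) := by positivity
  rw [rate, div_lt_one (by positivity)]
  linarith

theorem rate_le {a b : ℕ} (d : ℕ) (ha : 1 ≤ a) : rate a b d ≤ (1 + 1 / (b : ℝ)) / a := by
  have ha' : (0 : ℝ) < a := by exact_mod_cast ha
  have hx : 0 ≤ 1 / ((a : ℝ) * d * (b : ℝ) ^ 2) := by positivity
  exact div_le_div_of_nonneg_left (by positivity) ha'
    (le_mul_of_one_le_right ha'.le (by linarith))

theorem dimFilter_top : dimFilter ⊤ = atTop := rfl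

theorem dimFilter_coe (b : ℕ+) : dimFilter b = pure b := rfl

/-- Nontriviality keeps the upper limit of a nonnegative function nonnegative; along the trivial
filter it would be -∞. -/
instance neBot_dimFilter (β : WithTop ℕ+) : (dimFilter β).NeBot := by
  induction β using WithTop.recTopCoe with
  | top => rw [dimFilter_top]; infer_instance
  | coe b => rw [dimFilter_coe]; infer_instance

theorem eventually_two_le {β : WithTop ℕ+} (hβ : β ≠ 1) : ∀ᶠ b : ℕ+ in dimFilter β, (2 : ℕ) ≤ b := by
  induction β using WithTop.recTopCoe with
  | top =>
    rw [dimFilter_top]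
    filter_upwards [eventually_ge_atTop (2 : ℕ+)] with b hb
    exact_mod_cast hb
  | coe b =>
    rw [dimFilter_coe, eventually_pure]
    have h1 : b ≠ 1 := fun h => hβ (by rw [h, WithTop.coe_one])
    have h2 : (b : ℕ) ≠ 1 := fun h => h1 (PNat.eq h)
    have := b.pos
    omega

/-- By (1 + 1/b)/a, the rate is at most 2/3 for a ≥ 3 and at most 3/4 for a = 2, b ≥ 2, uniformly in
d. For a = 2, b = 1 it equals 1/(1 + 1/(2d)), which is below 1 at finite d but tends to 1 as d
grows; hence the exclusion. -/
theorem exists_rate_le {a : ℕ} {β δ : WithTop ℕ+} (ha : 2 ≤ a)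
    (h : ¬(a = 2 ∧ β = 1 ∧ δ = ⊤)) :
    ∃ ρ : ℝ, 0 ≤ ρ ∧ ρ < 1 ∧ ∀ᶠ p in dimFilter β ×ˢ dimFilter δ, rate a p.1 p.2 ≤ ρ := by
  have ha0 : (0 : ℝ) < a := by exact_mod_cast (by omega : 0 < a)
  by_cases ha3 : 3 ≤ a
  · refine ⟨2 / 3, by norm_num, by norm_num, Eventually.of_forall fun p => ?_⟩
    have ha' : (3 : ℝ) ≤ a := by exact_mod_cast ha3
    have hb : (1 : ℝ) ≤ (p.1 : ℕ) := by exact_mod_cast p.1.pos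
    have hi : 1 / ((p.1 : ℕ) : ℝ) ≤ 1 := by rw [div_le_one (by linarith)]; exact hb
    exact (rate_le _ (by omega)).trans (div_le_div₀ (by norm_num) (by linarith) (by norm_num) ha')
  obtain rfl : a = 2 := by omega
  by_cases hβ : β = 1
  · subst hβ
    induction δ using WithTop.recTopCoe with
    | top => exact absurd ⟨rfl, rfl, rfl⟩ h
    | coe d =>
      refine ⟨rate 2 (1 : ℕ+) d, rate_nonneg _ _ _, rate_lt_one le_rfl le_rfl d.pos, ?_⟩
      rw [← WithTop.coe_one, dimFilter_coe, dimFilter_coe, prod_pure_pure, eventually_pure]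
  · refine ⟨3 / 4, by norm_num, by norm_num, ?_⟩
    filter_upwards [(eventually_two_le hβ).prod_inl (dimFilter δ)] with p hp
    have hb : (2 : ℝ) ≤ (p.1 : ℕ) := by exact_mod_cast hp
    have hi : 1 / ((p.1 : ℕ) : ℝ) ≤ 1 / 2 := one_div_le_one_div_of_le two_pos hb
    refine (rate_le _ (by omega)).trans ?_
    push_cast
    linarith

theorem States.invEffDim_train_le {bc : BC} {n a b d : ℕ} (S : States (train bc n) a b d)
    (hn : 2 ≤ n) (ha : 1 ≤ a) (hb : 1 ≤ b) (hd : 1 ≤ d) : S.invEffDim ≤ 2 * rate a b d ^ n :=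
  (S.invEffDim_le ha hb hd).trans (bound_train_le bc hn ha hb hd)

theorem tendsto_two_mul_pow {ρ : ℝ} (h0 : 0 ≤ ρ) (h1 : ρ < 1) :
    Tendsto (fun n : ℕ => 2 * ρ ^ n) atTop (𝓝 0) := by
  simpa using (tendsto_pow_atTop_nhds_zero_of_lt_one h0 h1).const_mul 2

theorem tendsto_invEffDim {bc : BC} {a b d : ℕ} (ha : 2 ≤ a) (hb : 1 ≤ b) (hd : 1 ≤ d)
    (S : (n : ℕ) → States (train bc n) a b d) :
    Tendsto (fun n => (S n).invEffDim) atTop (𝓝 0) := by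
  refine tendsto_of_tendsto_of_tendsto_of_le_of_le' tendsto_const_nhds
    (tendsto_two_mul_pow (rate_nonneg a b d) (rate_lt_one ha hb hd))
    (Eventually.of_forall fun n => (S n).invEffDim_nonneg) ?_
  filter_upwards [eventually_ge_atTop 2] with n hn
  exact (S n).invEffDim_train_le hn (by omega) hb hd

theorem tendsto_upperLim_invEffDim {bc : BC} {a : ℕ} {β δ : WithTop ℕ+} (ha : 2 ≤ a)
    (h : ¬(a = 2 ∧ β = 1 ∧ δ = ⊤)) (S : (n : ℕ) → (b d : ℕ+) → States (train bc n) a b d) :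
    Tendsto (fun n => upperLim (fun b d => (S n b d).invEffDim) β δ) atTop (𝓝 0) := by
  obtain ⟨ρ, h0, h1, hρ⟩ := exists_rate_le ha h
  have hlim : Tendsto (fun n : ℕ => ((2 * ρ ^ n : ℝ) : EReal)) atTop (𝓝 0) :=
    (continuous_coe_real_ereal.tendsto 0).comp (tendsto_two_mul_pow h0 h1)
  refine tendsto_of_tendsto_of_tendsto_of_le_of_le' tendsto_const_nhds hlim
    (Eventually.of_forall fun n => ?_) ?_
  · rw [upperLim]
    conv_lhs => rw [← limsup_const (f := dimFilter β ×ˢ dimFilter δ) (0 : EReal)]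
    refine limsup_le_limsup (Eventually.of_forall fun p => ?_)
    exact EReal.coe_nonneg.2 (S n p.1 p.2).invEffDim_nonneg
  · filter_upwards [eventually_ge_atTop 2] with n hn
    refine limsup_le_of_le (by isBoundedDefault) ?_
    filter_upwards [hρ] with p hp
    refine EReal.coe_le_coe_iff.2 (((S n p.1 p.2).invEffDim_train_le hn (by omega) p.1.pos
      p.2.pos).trans ?_)
    have := rate_nonneg a p.1 p.2
    gcongr

end Limits

end RTN

end

theorem mainTheorem7 :
    -- closed forms of the Ising partition functions
    (∀ n b : ℕ, 1 ≤ n → 1 ≤ b →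
      (train .opn n).isingZ (Real.log (Real.sqrt b)) = 2 * (1 + 1 / (b : ℝ)) ^ (n - 1) ∧
      (train .closed n).isingZ (Real.log (Real.sqrt b)) =
        (1 + 1 / (b : ℝ)) ^ n + (1 - 1 / (b : ℝ)) ^ n) ∧
    -- inverse effective dimension, open chain
    (∀ n a b d : ℕ, 2 ≤ n → 1 ≤ a → 1 ≤ b → 1 ≤ d → ∀ S : States (train .opn n) a b d,
      S.invEffDim ≤ 2 * (1 + 1 / (b : ℝ)) ^ (n - 1) /
        ((a : ℝ) ^ n * (1 + 1 / ((a : ℝ) * d * b)) ^ 2 *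
          (1 + 1 / ((a : ℝ) * d * (b : ℝ) ^ 2)) ^ (n - 2)) ∧
      (S.Unentangled → S.invEffDim = 2 * (1 + 1 / (b : ℝ)) ^ (n - 1) /
        ((a : ℝ) ^ n * (1 + 1 / ((a : ℝ) * d * b)) ^ 2 *
          (1 + 1 / ((a : ℝ) * d * (b : ℝ) ^ 2)) ^ (n - 2)))) ∧
    -- inverse effective dimension, closed chain
    (∀ n a b d : ℕ, 1 ≤ n → 1 ≤ a → 1 ≤ b → 1 ≤ d → ∀ S : States (train .closed n) a b d,
      S.invEffDim ≤ ((1 + 1 / (b : ℝ)) ^ n + (1 - 1 / (b : ℝ)) ^ n) /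
        ((a : ℝ) ^ n * (1 + 1 / ((a : ℝ) * d * (b : ℝ) ^ 2)) ^ n) ∧
      (S.Unentangled → S.invEffDim = ((1 + 1 / (b : ℝ)) ^ n + (1 - 1 / (b : ℝ)) ^ n) /
        ((a : ℝ) ^ n * (1 + 1 / ((a : ℝ) * d * (b : ℝ) ^ 2)) ^ n))) ∧
    -- the bound `(2 / a) ^ n`
    (∀ (bc : BC) (n a b d : ℕ), 1 ≤ n → 1 ≤ a → 1 ≤ b → 1 ≤ d →
      ∀ S : States (train bc n) a b d, S.invEffDim ≤ (2 / (a : ℝ)) ^ n) ∧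
    -- perfect equilibration at finite bond and logical dimensions
    (∀ (bc : BC) (a b d : ℕ), 2 ≤ a → 1 ≤ b → 1 ≤ d →
      ∀ S : (n : ℕ) → States (train bc n) a b d,
        Tendsto (fun n => (S n).invEffDim) atTop (𝓝 0)) ∧
    -- perfect equilibration at finite or infinite bond and logical dimensions
    (∀ (bc : BC) (a : ℕ) (β δ : WithTop ℕ+), 2 ≤ a → ¬(a = 2 ∧ β = 1 ∧ δ = ⊤) →
      ∀ S : (n : ℕ) → (b d : ℕ+) → States (train bc n) a b d,
        Tendsto (fun n => upperLim (fun b d => (S n b d).invEffDim) β δ) atTop (𝓝 0)) := by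
  refine ⟨fun n b hn hb => ?_, fun n a b d hn ha hb hd S => ?_, fun n a b d hn ha hb hd S => ?_,
    fun bc n a b d _ ha hb hd S => ?_, fun bc a b d ha hb hd S => tendsto_invEffDim ha hb hd S,
    fun bc a β δ ha h S => tendsto_upperLim_invEffDim ha h S⟩
  · rw [Graph.isingZ_eq_sum_weight _ hb, Graph.isingZ_eq_sum_weight _ hb, sum_weight_open _ hn,
      sum_weight_closed _ hn, one_div]
    exact ⟨rfl, rfl⟩
  · rw [← bound_open hn]
    exact ⟨S.invEffDim_le ha hb hd, S.invEffDim_eq ha hb hd⟩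
  · rw [← bound_closed hn]
    exact ⟨S.invEffDim_le ha hb hd, S.invEffDim_eq ha hb hd⟩
  · refine (S.invEffDim_le ha hb hd).trans (((train bc n).bound_le ha hb d).trans_eq ?_)
    rw [Fintype.card_fin, div_pow]
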